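/- Let $K$ be an algebraically closed field of characteristic zero, and let $A_n$ be the $n$-th Weyl algebra over $K$, generated by $p_1,\dots,p_n,q_1,\dots,q_n$ with relations $[p_i,p_j]=[q_i,q_j]=0$, $[q_i,p_j]=\delta_{ij}$. Identify $A_1\otimes_K A_1$ with $A_2$ in the usual way ($p\otimes 1=p_1$, $q\otimes 1=q_1$, $1\otimes p=p_2$, $1\otimes q=q_2$). For an element $z$ of an associative $K$-algebra $P$ let $\mathrm{ad}_z(x)=zx-xz$ and put $$\mathrm{Ev}(z)=\{\lambda\in K:\exists\,x\in P\setminus\{0\},\ \mathrm{ad}_z(x)=\lambda x\},\qquad F(z)=\{x\in P:\dim_K K[\mathrm{ad}_z](x)<\infty\},$$ $$N(z)=\{x\in P:\exists\,m,\ \mathrm{ad}_z^m(x)=0\},\qquad C(z)=\{x\in P:\mathrm{ad}_z(x)=0\},\qquad D(z)=\bigoplus_{\lambda\in \mathrm{Ev}(z)}\ker(\mathrm{ad}_z-\lambda).$$ Call $z$ nilpotent if $\mathrm{Ev}(z)=\{0\}$ and $C(z)\subsetneq N(z)$ (the case $N(z)=P$, strictly nilpotent, and the case $N(z)\subsetneq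 P$, weakly nilpotent, are both allowed); call $z$ semisimple if $\mathrm{Ev}(z)\supsetneq\{0\}$ and $D(z)=F(z)$ (again with $F(z)=P$ or $F(z)\subsetneq P$); and write $z\in\Omega_0'(P)$ if $\mathrm{Ev}(z)=\{0\}$ and $C(z)=F(z)\subsetneq P$. Let $z_1,z_2\in A_1\setminus K$ and $\Gamma=z_1\otimes 1+1\otimes z_2\in A_2$. (1) If $z_1$ is nilpotent and $z_2$ is semisimple, then the centralizer $C(\Gamma)$ of $\Gamma$ in $A_2$ is commutative. (2) If $z_1\in\Omega_0'(A_1)$ or $z_2\in\Omega_0'(A_1)$, then $C(\Gamma)$ is commutative. -/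

import Mathlib

open scoped TensorProduct

/-! ## The subspaces attached to an element of an associative algebra, and its type

An associative algebra is regarded as a non-commutative Poisson algebra whose bracket is the
commutator `{z, w} = z * w - w * z`. -/

namespace PoissonType

noncomputable section

variable (K : Type*) {P : Type*} [Field K] [Ring P] [Algebra K P]

/-- `ad_z : x ↦ z * x - x * z`. -/
def ad (z : P) : Module.End K P := LinearMap.mulLeft K z - LinearMap.mulRight K z

theorem ad_apply (z x : P) : ad K z x = z * x - x * z := rfl

/-- `Ev(z)`: the set of eigenvalues of `ad_z`. -/
def Ev (z : P) : Set K := {c | ∃ x : P, x ≠ 0 ∧ ad K z x = c • x}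

/-- `F(z)`, the torsion algebra: those `x` for which `K[ad_z](x)`, the span of the
`ad_z ^ n (x)`, is finite-dimensional. -/
def F (z : P) : Set P :=
  {x | FiniteDimensional K (Submodule.span K (Set.range fun n : ℕ => (ad K z ^ n) x))}

/-- `N(z)`, the nil-algebra. -/
def N (z : P) : Set P := {x | ∃ m : ℕ, (ad K z ^ m) x = 0}

/-- `C(z)`, the centralizer. -/
def C (z : P) : Set P := {x | ad K z x = 0}

/-- `D(z, c)`, the eigenspace of `ad_z` for `c`: all `x` with `ad_z x = c • x`. -/
def eigen (z : P) (c : K) : Submodule K P := Module.End.eigenspace (ad K z) c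

/-- `D(z)`, the eigenvalue algebra: the (automatically direct) sum of the eigenspaces `D(z, c)`,
`c ∈ Ev(z)`. -/
def D (z : P) : Set P := ((⨆ c ∈ Ev K z, eigen K z c : Submodule K P) : Set P)

/-- The class `Ω₀'`. -/
def Omega0' (z : P) : Prop := Ev K z = {0} ∧ C K z = F K z ∧ F K z ⊂ Set.univ

/-- The class `Ω₁` of strictly nilpotent elements. -/
def Omega1 (z : P) : Prop := Ev K z = {0} ∧ C K z ⊂ N K z ∧ N K z = Set.univ

/-- The class `Ω₁'` of weakly nilpotent elements. -/
def Omega1' (z : P) : Prop := Ev K z = {0} ∧ C K z ⊂ N K z ∧ N K z ⊂ Set.univ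

/-- The class `Ω₂` of strictly semisimple elements. -/
def Omega2 (z : P) : Prop := {0} ⊂ Ev K z ∧ D K z = F K z ∧ F K z = Set.univ

/-- The class `Ω₂'` of weakly semisimple elements. -/
def Omega2' (z : P) : Prop := {0} ⊂ Ev K z ∧ D K z = F K z ∧ F K z ⊂ Set.univ

/-- `z` is nilpotent: `z ∈ Ω₁ ∪ Ω₁'`. -/
def NilpotentType (z : P) : Prop := Omega1 K z ∨ Omega1' K z

/-- `z` is semisimple: `z ∈ Ω₂ ∪ Ω₂'`. -/
def SemisimpleType (z : P) : Prop := Omega2 K z ∨ Omega2' K z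

end

end PoissonType

/-! ## Weyl algebras -/

/-- The defining relations of the `n`-th Weyl algebra on the generators `p i = Sum.inl i` and
`q i = Sum.inr i`: `[p i, p j] = 0`, `[q i, q j] = 0`, `[q i, p j] = δ i j`. -/
inductive WeylRel (K : Type*) [Field K] (n : ℕ) :
    FreeAlgebra K (Fin n ⊕ Fin n) → FreeAlgebra K (Fin n ⊕ Fin n) → Prop
  | pp (i j : Fin n) : WeylRel K n
      (FreeAlgebra.ι K (Sum.inl i) * FreeAlgebra.ι K (Sum.inl j))
      (FreeAlgebra.ι K (Sum.inl j) * FreeAlgebra.ι K (Sum.inl i))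
  | qq (i j : Fin n) : WeylRel K n
      (FreeAlgebra.ι K (Sum.inr i) * FreeAlgebra.ι K (Sum.inr j))
      (FreeAlgebra.ι K (Sum.inr j) * FreeAlgebra.ι K (Sum.inr i))
  | qp (i j : Fin n) : WeylRel K n
      (FreeAlgebra.ι K (Sum.inr i) * FreeAlgebra.ι K (Sum.inl j))
      (FreeAlgebra.ι K (Sum.inl j) * FreeAlgebra.ι K (Sum.inr i) + if i = j then 1 else 0)

/-- The `n`-th Weyl algebra `A_n` over `K`. -/
def WeylAlgebra (K : Type*) [Field K] (n : ℕ) : Type _ := RingQuot (WeylRel K n)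

namespace WeylAlgebra

noncomputable section

variable {K : Type*} [Field K] {n : ℕ}

instance : Ring (WeylAlgebra K n) := inferInstanceAs (Ring (RingQuot (WeylRel K n)))

instance : Algebra K (WeylAlgebra K n) := inferInstanceAs (Algebra K (RingQuot (WeylRel K n)))

/-- The quotient map from the free algebra. -/
def mk : FreeAlgebra K (Fin n ⊕ Fin n) →ₐ[K] WeylAlgebra K n :=
  RingQuot.mkAlgHom K (WeylRel K n)

/-- The generator `p i`. -/
def p (i : Fin n) : WeylAlgebra K n := mk (FreeAlgebra.ι K (Sum.inl i))

/-- The generator `q i`. -/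
def q (i : Fin n) : WeylAlgebra K n := mk (FreeAlgebra.ι K (Sum.inr i))

theorem p_mul_p (i j : Fin n) : (p i * p j : WeylAlgebra K n) = p j * p i := by
  simp only [p, ← map_mul]
  exact RingQuot.mkAlgHom_rel K (WeylRel.pp i j)

theorem q_mul_q (i j : Fin n) : (q i * q j : WeylAlgebra K n) = q j * q i := by
  simp only [q, ← map_mul]
  exact RingQuot.mkAlgHom_rel K (WeylRel.qq i j)

theorem q_mul_p (i j : Fin n) :
    (q i * p j : WeylAlgebra K n) = p j * q i + if i = j then 1 else 0 := by
  have h : mk _ = mk _ := RingQuot.mkAlgHom_rel K (WeylRel.qp (K := K) i j)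
  rw [map_mul, map_add, map_mul] at h
  refine h.trans ?_
  congr 1
  split_ifs <;> simp

/-- The universal property of `A_n`. -/
def lift {B : Type*} [Ring B] [Algebra K B] (f g : Fin n → B)
    (hf : ∀ i j, f i * f j = f j * f i) (hg : ∀ i j, g i * g j = g j * g i)
    (hgf : ∀ i j, g i * f j = f j * g i + if i = j then 1 else 0) :
    WeylAlgebra K n →ₐ[K] B :=
  RingQuot.liftAlgHom K ⟨FreeAlgebra.lift K (Sum.elim f g), by
    intro x y h
    induction h with
    | pp i j => simpa using hf i j
    | qq i j => simpa using hg i j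
    | qp i j =>
      have := hgf i j
      split_ifs at this ⊢ <;> simpa using this⟩

section
variable {B : Type*} [Ring B] [Algebra K B] (f g : Fin n → B)
    (hf : ∀ i j, f i * f j = f j * f i) (hg : ∀ i j, g i * g j = g j * g i)
    (hgf : ∀ i j, g i * f j = f j * g i + if i = j then 1 else 0)

@[simp] theorem lift_p (i : Fin n) : lift (K := K) f g hf hg hgf (p i) = f i := by
  refine (RingQuot.liftAlgHom_mkAlgHom_apply K _ _ _).trans ?_
  simp

@[simp] theorem lift_q (i : Fin n) : lift (K := K) f g hf hg hgf (q i) = g i := by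
  refine (RingQuot.liftAlgHom_mkAlgHom_apply K _ _ _).trans ?_
  simp

end

theorem algHom_ext {B : Type*} [Ring B] [Algebra K B] {φ ψ : WeylAlgebra K n →ₐ[K] B}
    (hp : ∀ i, φ (p i) = ψ (p i)) (hq : ∀ i, φ (q i) = ψ (q i)) : φ = ψ := by
  refine RingQuot.ringQuot_ext' K φ ψ (FreeAlgebra.hom_ext ?_)
  funext x
  rcases x with i | i
  · exact hp i
  · exact hq i

/-- The embedding `A_1 → A_n` onto the `i`-th pair of generators: `p ↦ p i`, `q ↦ q i`. -/
def incl (i : Fin n) : WeylAlgebra K 1 →ₐ[K] WeylAlgebra K n :=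
  lift (fun _ => p i) (fun _ => q i) (fun _ _ => rfl) (fun _ _ => rfl) (fun a b => by
    rw [q_mul_p, if_pos rfl, if_pos (Subsingleton.elim a b)])

@[simp] theorem incl_p (i : Fin n) (a : Fin 1) : incl (K := K) i (p a) = p i := by simp [incl]

@[simp] theorem incl_q (i : Fin n) (a : Fin 1) : incl (K := K) i (q a) = q i := by simp [incl]

theorem mem_of_gens (S : Subalgebra K (WeylAlgebra K n)) (hp : ∀ i, p i ∈ S)
    (hq : ∀ i, q i ∈ S) (x : WeylAlgebra K n) : x ∈ S := by
  let φ : WeylAlgebra K n →ₐ[K] S := lift (fun i => ⟨p i, hp i⟩) (fun i => ⟨q i, hq i⟩)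
    (fun i j => Subtype.ext (p_mul_p i j)) (fun i j => Subtype.ext (q_mul_q i j))
    (fun i j => Subtype.ext (by
      have := q_mul_p (K := K) i j
      split_ifs at this ⊢ <;> simpa using this))
  have h : S.val.comp φ = AlgHom.id K _ := algHom_ext (by simp [φ]) (by simp [φ])
  have h' : ((φ x : S) : WeylAlgebra K n) = x := DFunLike.congr_fun h x
  exact h' ▸ (φ x).2

theorem incl_commute {i j : Fin n} (hij : i ≠ j) (x y : WeylAlgebra K 1) :
    Commute (incl i x) (incl j y) := by
  have hpq : Commute (p i : WeylAlgebra K n) (q j) := by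
    have := q_mul_p (K := K) j i
    rw [if_neg hij.symm, add_zero] at this
    exact this.symm
  have hqp : Commute (q i : WeylAlgebra K n) (p j) := by
    have := q_mul_p (K := K) i j
    rw [if_neg hij, add_zero] at this
    exact this
  have key : ∀ g : WeylAlgebra K n, Commute g (p j) → Commute g (q j) →
      ∀ y, Commute g (incl j y) := by
    intro g h1 h2 y
    have := mem_of_gens ((Subalgebra.centralizer K {g}).comap (incl j))
      (by intro a; simpa [Subalgebra.mem_centralizer_iff] using h1.eq)
      (by intro a; simpa [Subalgebra.mem_centralizer_iff] using h2.eq) y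
    simpa [Subalgebra.mem_centralizer_iff, commute_iff_eq] using this
  have := mem_of_gens ((Subalgebra.centralizer K {incl j y}).comap (incl i))
      (by
        intro a
        simpa [Subalgebra.mem_centralizer_iff] using (key (p i) (p_mul_p i j) hpq y).eq.symm)
      (by
        intro a
        simpa [Subalgebra.mem_centralizer_iff] using (key (q i) hqp (q_mul_q i j) y).eq.symm) x
  exact Eq.symm (by simpa [Subalgebra.mem_centralizer_iff] using this)

/-- The inverse of the canonical isomorphism `A_1 ⊗ A_1 ≃ A_2`. -/
def toTensor : WeylAlgebra K 2 →ₐ[K] WeylAlgebra K 1 ⊗[K] WeylAlgebra K 1 :=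
  lift ![p 0 ⊗ₜ 1, 1 ⊗ₜ p 0] ![q 0 ⊗ₜ 1, 1 ⊗ₜ q 0]
    (by simp [Fin.forall_fin_two])
    (by simp [Fin.forall_fin_two])
    (by simp [Fin.forall_fin_two, q_mul_p, TensorProduct.add_tmul, TensorProduct.tmul_add,
          Algebra.TensorProduct.one_def])

/-- The canonical isomorphism `A_1 ⊗ A_1 ≃ A_2`, `p ⊗ 1 ↦ p 0`, `q ⊗ 1 ↦ q 0`, `1 ⊗ p ↦ p 1`,
`1 ⊗ q ↦ q 1`, by which the two algebras are identified. -/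
def tensorEquiv : WeylAlgebra K 1 ⊗[K] WeylAlgebra K 1 ≃ₐ[K] WeylAlgebra K 2 :=
  AlgEquiv.ofAlgHom
    (Algebra.TensorProduct.lift (incl 0) (incl 1) (fun x y => incl_commute (by decide) x y))
    toTensor
    (algHom_ext (by simp [Fin.forall_fin_two, toTensor]) (by simp [Fin.forall_fin_two, toTensor]))
    (Algebra.TensorProduct.ext
      (algHom_ext (by simp [toTensor, Fin.forall_fin_one])
        (by simp [toTensor, Fin.forall_fin_one]))
      (algHom_ext (by simp [toTensor, Fin.forall_fin_one])
        (by simp [toTensor, Fin.forall_fin_one])))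

end

end WeylAlgebra

/-! On `A_1 ⊗ A_1`, the operator `ad Γ` is `T ⊗ 1 + 1 ⊗ U` with `T = ad z₁` and `U = ad z₂`. The
point is that, under either hypothesis, its kernel is no larger than `ker T ⊗ ker U`. This is the
tensor product of the centralizers of `z₁` and `z₂`, so it is commutative once these are.

Kernel: contracting `x ∈ ker (ad Γ)` with linear forms on one factor gives a finite-dimensional
space of slices, and `T (φ·x) = -(φ ∘ U)·x` shows that it is `T`-stable. So all slices lie in `F
z₁`, and symmetrically in `F z₂` for the other factor. If `F = C` for one factor, that factor's
operator kills `x`, hence so does the other (`rTensor_eq_zero_of_C_eq_F`). If `z₁` is nilpotent, `Ev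
z₁ = {0}` makes `T` nilpotent on its slices, so a power of `T ⊗ 1`, and therefore of `1 ⊗ U`, kills
`x`. Slices in `F z₂ = D z₂` are sums of eigenvectors of `U`, and on these `U ^ n w = 0` implies `U
w = 0` (`rTensor_eq_zero_of_nilpotent_of_D_eq_F`).

Centralizers in `A_1` (`commute_of_commute_nonscalar`): elements are written `∑ aᵢ(q) pⁱ` and
filtered by order in `p`. Commuting elements have Poisson-commuting leading terms, so in `C z` with
`order z > 0` two elements of equal order agree up to a scalar modulo lower order. Moreover the
orders modulo `order z` form a cyclic group. Approximating by monomials in `z` and one further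
element `y` yields commutativity. -/

namespace WeylAlgebra

noncomputable section

open Polynomial

/-! ### Normal ordering in the first Weyl algebra. -/

section Model

variable {K : Type*} [Field K]

theorem coeff_sum_monomial_derivative (f : K[X][X]) (i : ℕ) :
    (f.sum fun i a => monomial i (derivative a)).coeff i = derivative (f.coeff i) := by
  simp only [Polynomial.sum_def, finsetSum_coeff, coeff_monomial, Finset.sum_ite_eq']
  split_ifs with h
  · rfl
  · rw [notMem_support_iff.1 h, derivative_zero]

/-- Differentiation of the coefficients of a polynomial over `K[X]`. -/
def coeffDeriv : K[X][X] →ₗ[K] K[X][X] where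
  toFun f := f.sum fun i a => monomial i (derivative a)
  map_add' f g := sum_add_index f g _ (by simp) (by simp)
  map_smul' c f := by
    ext1 i
    simp only [coeff_smul, RingHom.id_apply, coeff_sum_monomial_derivative, derivative_smul]

theorem coeff_coeffDeriv (f : K[X][X]) (i : ℕ) :
    (coeffDeriv f).coeff i = derivative (f.coeff i) :=
  coeff_sum_monomial_derivative f i

theorem coeffDeriv_C_mul (a : K[X]) (f : K[X][X]) :
    coeffDeriv (C a * f) = C (derivative a) * f + C a * coeffDeriv f := by
  ext1 i
  simp [coeff_coeffDeriv, derivative_mul]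

theorem coeffDeriv_X_mul (f : K[X][X]) : coeffDeriv (X * f) = X * coeffDeriv f := by
  ext1 i
  cases i <;> simp [coeff_coeffDeriv]

theorem coeffDeriv_monomial (i : ℕ) (a : K[X]) :
    coeffDeriv (monomial i a) = monomial i (derivative a) := by
  ext1 j
  simp only [coeff_coeffDeriv, coeff_monomial]
  split_ifs <;> simp

theorem natDegree_coeffDeriv_le (f : K[X][X]) : (coeffDeriv f).natDegree ≤ f.natDegree := by
  refine natDegree_le_iff_coeff_eq_zero.2 fun i hi => ?_
  rw [coeff_coeffDeriv, coeff_eq_zero_of_natDegree_lt hi, derivative_zero]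

/-- The operator on `K[X][X]` by which the generator `p` acts. -/
def pOp : Module.End K K[X][X] := LinearMap.mulLeft K X - coeffDeriv

theorem pOp_apply (f : K[X][X]) : pOp f = X * f - coeffDeriv f := rfl

theorem natDegree_pOp_le (f : K[X][X]) : (pOp f).natDegree ≤ f.natDegree + 1 := by
  rw [pOp_apply]
  refine (natDegree_sub_le _ _).trans (max_le ?_ ((natDegree_coeffDeriv_le f).trans (by omega)))
  exact natDegree_mul_le.trans (by rw [natDegree_X]; omega)

/-- The action of the first Weyl algebra on normally ordered symbols. -/
def action : WeylAlgebra K 1 →ₐ[K] Module.End K K[X][X] :=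
  lift (fun _ => pOp) (fun _ => LinearMap.mulLeft K (C X)) (fun _ _ => rfl) (fun _ _ => rfl)
    (fun i j => by
      rw [if_pos (Subsingleton.elim i j)]
      refine LinearMap.ext fun f => ?_
      simp only [Module.End.mul_apply, LinearMap.mulLeft_apply, LinearMap.add_apply, pOp_apply,
        coeffDeriv_C_mul, derivative_X, map_one, Module.End.one_apply]
      ring)

theorem action_p (f : K[X][X]) : action (p 0) f = X * f - coeffDeriv f := by
  simp [action, pOp_apply]

theorem action_q (f : K[X][X]) : action (q 0) f = C X * f := by
  simp [action]

/-- The normally ordered symbol `∑ aᵢ(q) Xⁱ` of an element `∑ aᵢ(q) pⁱ`. -/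
def symbol : WeylAlgebra K 1 →ₗ[K] K[X][X] :=
  LinearMap.applyₗ (1 : K[X][X]) ∘ₗ (action (K := K)).toLinearMap

theorem symbol_apply (u : WeylAlgebra K 1) : symbol u = action u 1 := rfl

theorem symbol_one : symbol (1 : WeylAlgebra K 1) = 1 := by simp [symbol_apply]

theorem symbol_mul (u v : WeylAlgebra K 1) : symbol (u * v) = action u (symbol v) := by
  simp [symbol_apply]

/-- The element `∑ aᵢ(q) pⁱ` with symbol `∑ aᵢ(q) Xⁱ`. -/
def ofSymbol (f : K[X][X]) : WeylAlgebra K 1 :=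
  f.eval₂ (aeval (R := K) (q 0 : WeylAlgebra K 1)).toRingHom (p 0)

theorem ofSymbol_add (f g : K[X][X]) : ofSymbol (f + g) = ofSymbol f + ofSymbol g :=
  eval₂_add _ _

theorem ofSymbol_monomial (i : ℕ) (a : K[X]) :
    ofSymbol (monomial i a) = aeval (q 0 : WeylAlgebra K 1) a * p 0 ^ i :=
  eval₂_monomial _ _

theorem ofSymbol_smul (c : K) (f : K[X][X]) : ofSymbol (c • f) = c • ofSymbol f := by
  induction f using Polynomial.induction_on' with
  | add f g hf hg => rw [smul_add, ofSymbol_add, hf, hg, ofSymbol_add, smul_add]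
  | monomial i a => rw [smul_monomial, ofSymbol_monomial, ofSymbol_monomial, map_smul, smul_mul_assoc]

theorem ofSymbol_sub (f g : K[X][X]) : ofSymbol (f - g) = ofSymbol f - ofSymbol g := by
  rw [sub_eq_add_neg, ofSymbol_add, ← neg_one_smul K g, ofSymbol_smul, neg_one_smul,
    sub_eq_add_neg]

theorem aeval_q_mul_p (a : K[X]) :
    aeval (q 0 : WeylAlgebra K 1) a * p 0 =
      p 0 * aeval (q 0) a + aeval (q 0) (derivative a) := by
  have hqp : (q 0 * p 0 : WeylAlgebra K 1) = p 0 * q 0 + 1 :=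
    (q_mul_p 0 0).trans (by rw [if_pos rfl])
  induction a using Polynomial.induction_on with
  | C c =>
    simp only [aeval_C, derivative_C, map_zero, add_zero]
    exact Algebra.commutes _ _
  | add a b ha hb => simp only [map_add, add_mul, mul_add, ha, hb]; abel
  | monomial n c ih =>
    have e : (C c * X ^ (n + 1) : K[X]) = (C c * X ^ n) * X := by rw [pow_succ, mul_assoc]
    rw [e]
    generalize (C c * X ^ n : K[X]) = b at ih
    rw [derivative_mul, derivative_X, mul_one, map_add, map_mul, map_mul, aeval_X, mul_assoc, hqp,
      mul_add, ← mul_assoc, ih, add_mul, mul_one, mul_assoc]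
    abel

/-- The action is left multiplication in normally ordered form: the elements `u` with this property
form a subalgebra, and it contains the generators because `p a(q) = a(q) p - a'(q)`. Taking `f = 1`
recovers `u` from its symbol, so normal forms are unique. -/
theorem ofSymbol_action (u : WeylAlgebra K 1) (f : K[X][X]) :
    ofSymbol (action u f) = u * ofSymbol f := by
  let S : Subalgebra K (WeylAlgebra K 1) :=
    { carrier := {u | ∀ f, ofSymbol (action u f) = u * ofSymbol f}
      mul_mem' := fun {u v} hu hv f => by
        rw [map_mul, Module.End.mul_apply, hu, hv, mul_assoc]
      add_mem' := fun {u v} hu hv f => by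
        rw [map_add, LinearMap.add_apply, ofSymbol_add, hu, hv, add_mul]
      algebraMap_mem' := fun c f => by
        rw [AlgHom.commutes, Module.algebraMap_end_apply, ofSymbol_smul, Algebra.smul_def] }
  refine mem_of_gens S (fun i f => ?_) (fun i f => ?_) u f
  · obtain rfl := Subsingleton.elim i 0
    rw [action_p, ofSymbol_sub]
    induction f using Polynomial.induction_on' with
    | add f g hf hg =>
      rw [mul_add, map_add, ofSymbol_add, ofSymbol_add, ofSymbol_add, mul_add, ← hf, ← hg]
      abel
    | monomial i a =>
      rw [X_mul_monomial, coeffDeriv_monomial, ofSymbol_monomial, ofSymbol_monomial,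
        ofSymbol_monomial, pow_succ', ← mul_assoc, aeval_q_mul_p, add_mul, add_sub_cancel_right,
        mul_assoc]
  · obtain rfl := Subsingleton.elim i 0
    rw [action_q]
    induction f using Polynomial.induction_on' with
    | add f g hf hg => rw [mul_add, ofSymbol_add, ofSymbol_add, mul_add, ← hf, ← hg]
    | monomial i a =>
      rw [C_mul_monomial, ofSymbol_monomial, ofSymbol_monomial, map_mul, aeval_X, mul_assoc]

theorem ofSymbol_symbol (u : WeylAlgebra K 1) : ofSymbol (symbol u) = u := by
  have h : ofSymbol (1 : K[X][X]) = (1 : WeylAlgebra K 1) := by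
    rw [← monomial_zero_one, ofSymbol_monomial]; simp
  rw [symbol_apply, ofSymbol_action, h, mul_one]

theorem symbol_injective : Function.Injective (symbol (K := K)) :=
  Function.LeftInverse.injective ofSymbol_symbol

theorem action_aeval_q (a : K[X]) (f : K[X][X]) :
    action (aeval (q 0 : WeylAlgebra K 1) a) f = C a * f := by
  induction a using Polynomial.induction_on generalizing f with
  | C c =>
    rw [aeval_C, AlgHom.commutes, Module.algebraMap_end_apply]
    ext; simp
  | add a b ha hb => simp [ha, hb, add_mul]
  | monomial n c ih =>
    rw [pow_succ, ← mul_assoc, map_mul, map_mul, Module.End.mul_apply, aeval_X, action_q, ih,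
      C_mul (a := C c * X ^ n), mul_assoc]

theorem action_p_pow (i : ℕ) (f : K[X][X]) :
    action (p 0 ^ i) f = (pOp ^ i) f := by
  simp [action]

/-- Multiplication by `X` commutes with `coeffDeriv`, so this is the binomial expansion of `(X - ∂)
^ i` up to the linear term in `∂`. The bound on `k` admits the degrees from `i + m - 1` upwards,
where higher powers of `∂` do not contribute. For `i = 0` the truncated exponent is harmless because
its factor is zero. -/
theorem coeff_pOp_pow (i : ℕ) (g : K[X][X]) (m k : ℕ) (hg : g.natDegree ≤ m)
    (hk : i + m ≤ k + 1) :
    ((pOp ^ i) g).coeff k = (X ^ i * g - (i : K[X][X]) * X ^ (i - 1) * coeffDeriv g).coeff k := by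
  induction i generalizing g m with
  | zero => simp
  | succ i ih =>
    rw [pow_succ, Module.End.mul_apply,
      ih (pOp g) (m + 1) ((natDegree_pOp_le g).trans (by omega)) (by omega), pOp_apply,
      map_sub, coeffDeriv_X_mul]
    have hz : ((i : K[X][X]) * X ^ (i - 1) * coeffDeriv (coeffDeriv g)).coeff k = 0 := by
      rcases i with _ | i
      · simp
      refine coeff_eq_zero_of_natDegree_lt ?_
      have h1 := (natDegree_coeffDeriv_le (coeffDeriv g)).trans (natDegree_coeffDeriv_le g)
      have h2 : (((i + 1 : ℕ) : K[X][X]) * X ^ (i + 1 - 1)).natDegree ≤ i := by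
        refine natDegree_mul_le.trans ?_
        rw [natDegree_natCast, natDegree_X_pow]; omega
      have h3 := natDegree_mul_le (p := (((i + 1 : ℕ) : K[X][X]) * X ^ (i + 1 - 1)))
        (q := coeffDeriv (coeffDeriv g))
      omega
    have e : X ^ i * (X * g - coeffDeriv g) -
        (i : K[X][X]) * X ^ (i - 1) * (X * coeffDeriv g - coeffDeriv (coeffDeriv g)) =
        (X ^ (i + 1) * g - ((i + 1 : ℕ) : K[X][X]) * X ^ (i + 1 - 1) * coeffDeriv g) +
          (i : K[X][X]) * X ^ (i - 1) * coeffDeriv (coeffDeriv g) := by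
      rcases i with _ | i
      · simp
      · simp only [Nat.add_sub_cancel, Nat.cast_add, Nat.cast_one]; ring
    rw [e, coeff_add, hz, add_zero]

/-- The star product of symbols, up to terms of degree at least two lower than the top. -/
theorem coeff_action_ofSymbol (f g : K[X][X]) (n k : ℕ) (hf : f.natDegree ≤ n)
    (hk : n + g.natDegree ≤ k + 1) :
    (action (ofSymbol f) g).coeff k = (f * g - derivative f * coeffDeriv g).coeff k := by
  refine induction_with_natDegree_le
    (fun f => (action (ofSymbol f) g).coeff k = (f * g - derivative f * coeffDeriv g).coeff k)
    n ?_ ?_ ?_ f hf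
  · have : ofSymbol (0 : K[X][X]) = 0 := by simpa using ofSymbol_smul (0 : K) (0 : K[X][X])
    simp [this]
  · intro i a _ hi
    rw [C_mul_X_pow_eq_monomial, ofSymbol_monomial, map_mul, Module.End.mul_apply,
      action_aeval_q, action_p_pow, coeff_C_mul, coeff_pOp_pow i g g.natDegree k le_rfl (by omega),
      ← coeff_C_mul, ← C_mul_X_pow_eq_monomial, derivative_C_mul_X_pow, C_mul, map_natCast]
    congr 1
    ring
  · intro f g' _ _ h1 h2
    rw [ofSymbol_add, map_add, LinearMap.add_apply, coeff_add, h1, h2, ← coeff_add, map_add]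
    congr 1
    ring

theorem coeff_symbol_mul (u v : WeylAlgebra K 1) (k : ℕ)
    (hk : (symbol u).natDegree + (symbol v).natDegree ≤ k + 1) :
    (symbol (u * v)).coeff k =
      (symbol u * symbol v - derivative (symbol u) * coeffDeriv (symbol v)).coeff k := by
  rw [symbol_mul, ← coeff_action_ofSymbol _ _ _ _ le_rfl hk, ofSymbol_symbol]

end Model

end

end WeylAlgebra

namespace WeylAlgebra

noncomputable section

open Polynomial

/-! ### The order filtration and leading coefficients. -/

section Order

variable {K : Type*} [Field K]

/-- The order of an element of `A_1` in the generator `p`. -/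
def order (u : WeylAlgebra K 1) : ℕ := (symbol u).natDegree

/-- The coefficient of the highest power of `p` in an element of `A_1`. -/
def lead (u : WeylAlgebra K 1) : K[X] := (symbol u).leadingCoeff

theorem symbol_eq_zero_iff {u : WeylAlgebra K 1} : symbol u = 0 ↔ u = 0 :=
  map_eq_zero_iff _ symbol_injective

theorem lead_ne_zero {u : WeylAlgebra K 1} (hu : u ≠ 0) : lead u ≠ 0 :=
  leadingCoeff_ne_zero.2 (mt symbol_eq_zero_iff.1 hu)

/-- The factor `X` restores the degree lost by differentiation, so that top coefficients can be
compared without subtracting in `ℕ`. -/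
theorem natDegree_X_mul_derivative_le {R : Type*} [CommRing R] (f : R[X]) :
    (X * derivative f).natDegree ≤ f.natDegree := by
  refine natDegree_le_iff_coeff_eq_zero.2 fun i hi => ?_
  obtain ⟨i, rfl⟩ : ∃ j, i = j + 1 := ⟨i - 1, by omega⟩
  rw [coeff_X_mul, coeff_derivative, coeff_eq_zero_of_natDegree_lt hi, zero_mul]

theorem coeff_X_mul_derivative_natDegree {R : Type*} [CommRing R] (f : R[X]) :
    (X * derivative f).coeff f.natDegree = f.natDegree * f.leadingCoeff := by
  rw [leadingCoeff]
  rcases f.natDegree with _ | i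
  · simp
  · rw [coeff_X_mul, coeff_derivative]; push_cast; ring

theorem coeff_derivative_mul_coeffDeriv (f g : K[X][X]) (k : ℕ)
    (hk : f.natDegree + g.natDegree = k + 1) :
    (derivative f * coeffDeriv g).coeff k =
      f.natDegree * (f.leadingCoeff * derivative g.leadingCoeff) := by
  rw [← coeff_X_mul, ← hk, ← mul_assoc,
    coeff_mul_add_eq_of_natDegree_le (natDegree_X_mul_derivative_le f) (natDegree_coeffDeriv_le g),
    coeff_X_mul_derivative_natDegree, coeff_coeffDeriv, mul_assoc]
  rfl

theorem coeff_derivative_mul_coeffDeriv_eq_zero (f g : K[X][X]) (k : ℕ)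
    (hk : f.natDegree + g.natDegree ≤ k) : (derivative f * coeffDeriv g).coeff k = 0 := by
  rcases h : f.natDegree with _ | i
  · rw [natDegree_eq_zero.1 h |>.choose_spec.symm]; simp
  · refine coeff_eq_zero_of_natDegree_lt ?_
    have h1 := natDegree_derivative_lt (p := f) (by omega)
    have h2 := natDegree_coeffDeriv_le g
    have h3 := natDegree_mul_le (p := derivative f) (q := coeffDeriv g)
    omega

theorem order_mul_le (u v : WeylAlgebra K 1) : order (u * v) ≤ order u + order v := by
  refine natDegree_le_iff_coeff_eq_zero.2 fun k hk => ?_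
  simp only [order] at hk
  rw [coeff_symbol_mul u v k (by omega), coeff_sub,
    coeff_derivative_mul_coeffDeriv_eq_zero _ _ _ hk.le, sub_zero,
    coeff_eq_zero_of_natDegree_lt (natDegree_mul_le.trans_lt hk)]

theorem coeff_symbol_mul_order_add (u v : WeylAlgebra K 1) :
    (symbol (u * v)).coeff (order u + order v) = lead u * lead v := by
  rw [coeff_symbol_mul u v (order u + order v) (Nat.le_succ _), coeff_sub,
    coeff_derivative_mul_coeffDeriv_eq_zero _ _ (order u + order v) le_rfl, sub_zero]
  exact coeff_mul_degree_add_degree _ _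

instance : NoZeroDivisors (WeylAlgebra K 1) where
  eq_zero_or_eq_zero_of_mul_eq_zero {u v} h := by
    by_contra! hn
    have := coeff_symbol_mul_order_add u v
    rw [h, map_zero, coeff_zero] at this
    exact mul_ne_zero (lead_ne_zero hn.1) (lead_ne_zero hn.2) this.symm

instance : Nontrivial (WeylAlgebra K 1) :=
  ⟨1, 0, fun h => by simpa [symbol_one] using congrArg symbol h⟩

theorem order_mul {u v : WeylAlgebra K 1} (hu : u ≠ 0) (hv : v ≠ 0) :
    order (u * v) = order u + order v := by
  refine le_antisymm (order_mul_le u v) (le_natDegree_of_ne_zero ?_)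
  rw [coeff_symbol_mul_order_add]
  exact mul_ne_zero (lead_ne_zero hu) (lead_ne_zero hv)

theorem order_one : order (1 : WeylAlgebra K 1) = 0 := by simp [order, symbol_one]

theorem order_pow {u : WeylAlgebra K 1} (hu : u ≠ 0) (i : ℕ) : order (u ^ i) = i * order u := by
  induction i with
  | zero => simp [order_one]
  | succ i ih => rw [pow_succ, order_mul (pow_ne_zero i hu) hu, ih]; ring

theorem order_smul_le (c : K) (u : WeylAlgebra K 1) : order (c • u) ≤ order u := by
  rw [order, map_smul]
  exact natDegree_smul_le c _

theorem order_sub_le (u v : WeylAlgebra K 1) : order (u - v) ≤ max (order u) (order v) := by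
  rw [order, map_sub]
  exact natDegree_sub_le _ _

theorem order_commutator_le (u v : WeylAlgebra K 1) : order (u * v - v * u) ≤ order u + order v :=
  (order_sub_le _ _).trans (max_le (order_mul_le u v) ((order_mul_le v u).trans (add_comm _ _).le))

/-- One degree below the top of `u * v - v * u`, the symmetric product of the symbols cancels,
leaving the Poisson bracket of the leading terms, which must vanish. -/
theorem Commute.lead_eq {u v : WeylAlgebra K 1} (h : Commute u v) :
    (order u : K[X]) * (lead u * derivative (lead v)) =
      order v * (lead v * derivative (lead u)) := by
  rcases hk : order u + order v with _ | k
  · have h1 : order u = 0 := by omega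
    have h2 : order v = 0 := by omega
    rw [h1, h2]; simp
  · have h1 := coeff_symbol_mul u v k hk.le
    have h2 := coeff_symbol_mul v u k ((add_comm _ _).trans hk).le
    rw [h.eq, h2, mul_comm (symbol v), coeff_sub, coeff_sub, sub_right_inj,
      coeff_derivative_mul_coeffDeriv _ _ _ hk,
      coeff_derivative_mul_coeffDeriv _ _ _ ((add_comm _ _).trans hk)] at h1
    exact h1.symm

theorem coeff_mul_X_mul_derivative (a b : K[X]) :
    (a * (X * derivative b)).coeff (a.natDegree + b.natDegree) =
      a.leadingCoeff * (b.natDegree * b.leadingCoeff) := by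
  rw [coeff_mul_add_eq_of_natDegree_le le_rfl (natDegree_X_mul_derivative_le b),
    coeff_X_mul_derivative_natDegree]
  rfl

theorem eq_aeval_of_order_eq_zero {u : WeylAlgebra K 1} (hu : order u = 0) :
    ∃ a : K[X], u = aeval (q 0) a := by
  obtain ⟨a, ha⟩ := natDegree_eq_zero.1 hu
  refine ⟨a, ?_⟩
  rw [← ofSymbol_symbol u, ← ha, ← monomial_zero_left, ofSymbol_monomial, pow_zero, mul_one]

/-! ### Centralizers of non-scalar elements. -/

/-- The orders of the elements of the centralizer of `z` are, modulo `order z`, multiples of one of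
them. -/
theorem exists_order_generator {z : WeylAlgebra K 1} (hz : 0 < order z) :
    ∃ y : WeylAlgebra K 1, y ≠ 0 ∧ Commute y z ∧ ∀ c : WeylAlgebra K 1, c ≠ 0 → Commute c z →
      ∃ i j k : ℕ, i * order z + order c = k * order z + j * order y := by
  have : NeZero (order z) := ⟨hz.ne'⟩
  have hmul : ∀ {a b : ZMod (order z)},
      (∃ c : WeylAlgebra K 1, c ≠ 0 ∧ Commute c z ∧ (order c : ZMod (order z)) = a) →
      (∃ c : WeylAlgebra K 1, c ≠ 0 ∧ Commute c z ∧ (order c : ZMod (order z)) = b) →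
      ∃ c : WeylAlgebra K 1, c ≠ 0 ∧ Commute c z ∧ (order c : ZMod (order z)) = a + b := by
    rintro _ _ ⟨c, hc, hcz, rfl⟩ ⟨d, hd, hdz, rfl⟩
    exact ⟨c * d, mul_ne_zero hc hd, hcz.mul_left hdz, by rw [order_mul hc hd, Nat.cast_add]⟩
  let H : AddSubgroup (ZMod (order z)) :=
    { carrier := {a | ∃ c : WeylAlgebra K 1, c ≠ 0 ∧ Commute c z ∧ (order c : ZMod (order z)) = a}
      add_mem' := hmul
      zero_mem' := ⟨1, one_ne_zero, Commute.one_left z, by rw [order_one, Nat.cast_zero]⟩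
      neg_mem' := by
        rintro _ ⟨c, hc, hcz, rfl⟩
        -- Modulo `order z`, the order of this power is `(order z - 1) * order c`, that is, `-order
        -- c`.
        refine ⟨c ^ (order z - 1), pow_ne_zero _ hc, hcz.pow_left _, ?_⟩
        rw [order_pow hc, Nat.cast_mul, Nat.cast_pred hz, ZMod.natCast_self]
        ring }
  obtain ⟨⟨_, y, hy, hyz, rfl⟩, hg⟩ := IsAddCyclic.exists_generator (α := H)
  refine ⟨y, hy, hyz, fun c hc hcz => ?_⟩
  obtain ⟨j, hj⟩ := mem_multiples_iff_mem_zmultiples.2 (hg ⟨_, c, hc, hcz, rfl⟩)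
  have hj' : ((j * order y : ℕ) : ZMod (order z)) = order c := by
    simpa using congrArg Subtype.val hj
  have hmod := (ZMod.natCast_eq_natCast_iff _ _ _).1 hj'
  -- A congruence of natural numbers: the multiple of `order z` goes on whichever side is smaller,
  -- so one of `i`, `k` is zero.
  rcases le_total (order c) (j * order y) with h | h
  · obtain ⟨i, hi⟩ := (Nat.modEq_iff_dvd' h).1 hmod.symm
    exact ⟨i, j, 0, by rw [mul_comm i, ← hi]; omega⟩
  · obtain ⟨k, hk⟩ := (Nat.modEq_iff_dvd' h).1 hmod
    exact ⟨0, j, k, by rw [mul_comm k, ← hk]; omega⟩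

variable [CharZero K]

/-- Compare the top coefficients in `q` of the vanishing Poisson bracket; characteristic zero turns
the resulting equality in `K` into one in `ℕ`. -/
theorem Commute.natDegree_lead_eq {u v : WeylAlgebra K 1} (hu : u ≠ 0) (hv : v ≠ 0)
    (h : Commute u v) : order u * (lead v).natDegree = order v * (lead u).natDegree := by
  have h1 := congrArg
    (fun f : K[X] => (X * f).coeff ((lead u).natDegree + (lead v).natDegree)) (Commute.lead_eq h)
  simp only [mul_left_comm (X : K[X]), coeff_natCast_mul] at h1
  rw [coeff_mul_X_mul_derivative, add_comm, coeff_mul_X_mul_derivative] at h1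
  have h2 : (lead u).leadingCoeff * (lead v).leadingCoeff ≠ 0 :=
    mul_ne_zero (leadingCoeff_ne_zero.2 (lead_ne_zero hu)) (leadingCoeff_ne_zero.2 (lead_ne_zero hv))
  have h3 : ((order u * (lead v).natDegree : ℕ) : K) = (order v * (lead u).natDegree : ℕ) := by
    refine mul_right_cancel₀ h2 ?_
    push_cast
    linear_combination h1
  exact_mod_cast h3

/-- Elements of the same order in the centralizer of an element of positive order agree, up to a
scalar factor, modulo lower order. -/
theorem exists_sub_smul_eq_zero_or_order_lt {z u v : WeylAlgebra K 1} (hz : 0 < order z)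
    (hu : Commute u z) (hv : Commute v z) (hv0 : v ≠ 0) (huv : order u = order v) :
    ∃ c : K, u - c • v = 0 ∨ order (u - c • v) < order v := by
  have hz0 : z ≠ 0 := by rintro rfl; simp [order] at hz
  by_cases hu0 : u = 0
  · exact ⟨0, Or.inl (by simp [hu0])⟩
  refine ⟨(lead u).leadingCoeff / (lead v).leadingCoeff, ?_⟩
  set c := (lead u).leadingCoeff / (lead v).leadingCoeff with hc
  by_contra! hn
  obtain ⟨hw0, hw⟩ := hn
  have hle : order (u - c • v) ≤ order v :=
    (order_sub_le _ _).trans (max_le huv.le (order_smul_le _ _))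
  have hord : order (u - c • v) = order v := le_antisymm hle hw
  have hlead : lead (u - c • v) = lead u - c • lead v := by
    have : lead (u - c • v) = (symbol (u - c • v)).coeff (order (u - c • v)) := rfl
    rw [this, hord, map_sub, map_smul, coeff_sub, coeff_smul, ← huv]
    nth_rewrite 2 [huv]
    rfl
  have hwz : Commute (u - c • v) z := hu.sub_left (hv.smul_left c)
  -- For elements commuting with `z`, the order determines the `q`-degree of the leading
  -- coefficient. If the order did not drop, the difference would have that same `q`-degree, but `c`
  -- was chosen to cancel exactly this coefficient.
  have e1 := Commute.natDegree_lead_eq hz0 hw0 hwz.symm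
  have e2 := Commute.natDegree_lead_eq hz0 hu0 hu.symm
  have e3 := Commute.natDegree_lead_eq hz0 hv0 hv.symm
  rw [hord] at e1
  rw [huv] at e2
  have d1 : (lead (u - c • v)).natDegree = (lead u).natDegree :=
    Nat.eq_of_mul_eq_mul_left hz (e1.trans e2.symm)
  have d2 : (lead u).natDegree = (lead v).natDegree :=
    Nat.eq_of_mul_eq_mul_left hz (e2.trans e3.symm)
  refine leadingCoeff_ne_zero.2 (lead_ne_zero hw0) ?_
  have hlv : (lead v).leadingCoeff ≠ 0 := leadingCoeff_ne_zero.2 (lead_ne_zero hv0)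
  rw [leadingCoeff, d1, hlead, coeff_sub, coeff_smul, coeff_natDegree, d2, coeff_natDegree,
    smul_eq_mul, hc, div_mul_cancel₀ _ hlv, sub_self]

/-- Descent on the defect `order c + order e - order [c, e]`. Since monomials in `z` and `y` commute
with `e`, subtracting one from `z ^ i * c` lowers the order but leaves the commutator `z ^ i * [c,
e]`; so the defect strictly drops unless `[c, e] = 0`. -/
theorem commute_of_commute_generator {z y e : WeylAlgebra K 1} (hz : 0 < order z) (hy : y ≠ 0)
    (hyz : Commute y z)
    (hgen : ∀ c : WeylAlgebra K 1, c ≠ 0 → Commute c z →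
      ∃ i j k : ℕ, i * order z + order c = k * order z + j * order y)
    (hez : Commute e z) (hye : Commute y e) (c : WeylAlgebra K 1) (hcz : Commute c z) :
    Commute c e := by
  have hz0 : z ≠ 0 := by rintro rfl; simp [order] at hz
  induction hN : order c + order e - order (c * e - e * c) using Nat.strong_induction_on
    generalizing c with
  | _ N ih =>
  by_contra hce
  have hne : c * e - e * c ≠ 0 := fun h => hce (sub_eq_zero.1 h)
  have hc0 : c ≠ 0 := by rintro rfl; exact hce (Commute.zero_left e)
  obtain ⟨i, j, k, hijk⟩ := hgen c hc0 hcz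
  have hv0 : z ^ k * y ^ j ≠ 0 := mul_ne_zero (pow_ne_zero _ hz0) (pow_ne_zero _ hy)
  have hzp : ∀ i, z ^ i ≠ 0 := fun i => pow_ne_zero _ hz0
  have hu : order (z ^ i * c) = i * order z + order c := by
    rw [order_mul (hzp i) hc0, order_pow hz0]
  have hv : order (z ^ k * y ^ j) = k * order z + j * order y := by
    rw [order_mul (hzp k) (pow_ne_zero _ hy), order_pow hz0, order_pow hy]
  have hzz : ∀ i, Commute (z ^ i) z := fun i => (Commute.refl z).pow_left i
  have huz : Commute (z ^ i * c) z := (hzz i).mul_left hcz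
  have hvz : Commute (z ^ k * y ^ j) z := (hzz k).mul_left (hyz.pow_left j)
  have hve : Commute (z ^ k * y ^ j) e := (hez.symm.pow_left k).mul_left (hye.pow_left j)
  obtain ⟨a, ha⟩ := exists_sub_smul_eq_zero_or_order_lt hz huz hvz hv0 (by omega)
  set d := z ^ i * c - a • (z ^ k * y ^ j) with hd
  have hdz : Commute d z := huz.sub_left (hvz.smul_left a)
  have hde : d * e - e * d = z ^ i * (c * e - e * c) := by
    have h1 : (a • (z ^ k * y ^ j)) * e = e * (a • (z ^ k * y ^ j)) := (hve.smul_left a).eq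
    have h2 : e * (z ^ i * c) = z ^ i * (e * c) := by
      rw [← mul_assoc, (hez.pow_right i).eq, mul_assoc]
    rw [hd, sub_mul, mul_sub, h1, h2, mul_sub, mul_assoc]
    abel
  have hde0 : d * e - e * d ≠ 0 := hde ▸ mul_ne_zero (hzp i) hne
  have hlt : order d < order (z ^ k * y ^ j) :=
    ha.resolve_left fun h => hde0 (by rw [h]; simp)
  have hord : order (d * e - e * d) = i * order z + order (c * e - e * c) := by
    rw [hde, order_mul (hzp i) hne, order_pow hz0]
  -- These bounds keep the truncated subtractions in the defect genuine.
  have hb := order_commutator_le c e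
  have hb' := order_commutator_le d e
  exact hde0 (sub_eq_zero.2 (ih _ (by omega) d hdz rfl).eq)

/-- In characteristic zero, non-scalar elements of `A_1` have commutative centralizers. -/
theorem commute_of_commute_nonscalar {z : WeylAlgebra K 1}
    (hz : z ∉ Set.range (algebraMap K (WeylAlgebra K 1))) {u v : WeylAlgebra K 1}
    (hu : Commute u z) (hv : Commute v z) : Commute u v := by
  rcases Nat.eq_zero_or_pos (order z) with h0 | hpos
  -- Here `z` is a non-constant polynomial in `q`, and the bracket relation forces everything
  -- commuting with it to have order zero.
  · have hd : derivative (lead z) ≠ 0 := by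
      intro hd
      obtain ⟨k, hk⟩ := natDegree_eq_zero.1 (derivative_eq_zero.1 hd)
      obtain ⟨a, ha⟩ := natDegree_eq_zero.1 h0
      have hka : lead z = a := by rw [lead, ← ha, leadingCoeff_C]
      refine hz ⟨k, symbol_injective ?_⟩
      rw [← ha, ← hka, ← hk, Algebra.algebraMap_eq_smul_one, map_smul, symbol_one]
      ext; simp [← C_1, -map_one]
    have key : ∀ c : WeylAlgebra K 1, Commute c z → order c = 0 := by
      intro c hc
      by_cases hc0 : c = 0
      · simp [hc0, order]
      · have h := Commute.lead_eq hc
        rw [h0, Nat.cast_zero, zero_mul, mul_eq_zero, mul_eq_zero] at h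
        exact_mod_cast h.resolve_right (not_or.2 ⟨lead_ne_zero hc0, hd⟩)
    obtain ⟨a, rfl⟩ := eq_aeval_of_order_eq_zero (key u hu)
    obtain ⟨b, rfl⟩ := eq_aeval_of_order_eq_zero (key v hv)
    exact (Commute.all a b).map (aeval (q 0))
  · obtain ⟨y, hy, hyz, hgen⟩ := exists_order_generator hpos
    -- Used twice: with `e = y`, so that `y` commutes with all of the centralizer, and then with `e
    -- = v`.
    have hcent := fun {e} he hye => commute_of_commute_generator (e := e) hpos hy hyz hgen he hye
    exact hcent hv (hcent hyz (Commute.refl y) v hv).symm u hu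

end Order

end

end WeylAlgebra

/-! ### Linear algebra of `T ⊗ 1 + 1 ⊗ U`. -/

section KerTensor

open Module

variable {K V W : Type*} [Field K] [AddCommGroup V] [Module K V] [AddCommGroup W] [Module K W]

/-- Contraction of the second factor of a tensor with a linear form. -/
noncomputable def sliceRight (φ : Module.Dual K W) : V ⊗[K] W →ₗ[K] V :=
  (TensorProduct.rid K V).toLinearMap ∘ₗ φ.lTensor V

theorem sliceRight_tmul (φ : Module.Dual K W) (a : V) (b : W) :
    sliceRight φ (a ⊗ₜ[K] b) = φ b • a := by simp [sliceRight]

theorem eq_zero_of_sliceRight_eq_zero {x : V ⊗[K] W}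
    (h : ∀ φ : Module.Dual K W, sliceRight φ x = 0) : x = 0 := by
  let b := Module.Free.chooseBasis K W
  refine (TensorProduct.equivFinsuppOfBasisRight b).map_eq_zero_iff.1 (Finsupp.ext fun i => ?_)
  rw [TensorProduct.equivFinsuppOfBasisRight_apply]
  exact h (b.coord i)

theorem sliceRight_rTensor (φ : Module.Dual K W) (T : End K V) (x : V ⊗[K] W) :
    sliceRight φ (T.rTensor W x) = T (sliceRight φ x) := by
  induction x with
  | zero => simp
  | add x y hx hy => simp only [map_add, hx, hy]
  | tmul a b => simp [sliceRight_tmul]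

theorem sliceRight_lTensor (φ : Module.Dual K W) (U : End K W) (x : V ⊗[K] W) :
    sliceRight φ (U.lTensor V x) = sliceRight (φ ∘ₗ U) x := by
  induction x with
  | zero => simp
  | add x y hx hy => simp only [map_add, hx, hy]
  | tmul a b => simp [sliceRight_tmul]

/-- The contractions of a tensor form a finite-dimensional space, on which `T` acts if the tensor
is annihilated by `T ⊗ 1 + 1 ⊗ U`. -/
theorem exists_invariant_sliceRight {T : End K V} {U : End K W} {x : V ⊗[K] W}
    (h : T.rTensor W x + U.lTensor V x = 0) :
    ∃ S : Submodule K V, FiniteDimensional K S ∧ (∀ v ∈ S, T v ∈ S) ∧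
      ∀ φ, sliceRight φ x ∈ S := by
  let c : Module.Dual K W →ₗ[K] V :=
    { toFun := fun φ => sliceRight φ x
      map_add' := fun φ ψ => by
        simp [sliceRight, LinearMap.lTensor_add]
      map_smul' := fun a φ => by
        simp [sliceRight, LinearMap.lTensor_smul] }
  refine ⟨LinearMap.range c, ?_, ?_, fun φ => ⟨φ, rfl⟩⟩
  · have : ∀ x : V ⊗[K] W, ∃ S : Submodule K V, FiniteDimensional K S ∧
        ∀ φ, sliceRight φ x ∈ S := by
      intro x
      induction x with
      | zero => exact ⟨⊥, inferInstance, by simp⟩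
      | tmul a b =>
        refine ⟨K ∙ a, inferInstance, fun φ => ?_⟩
        rw [sliceRight_tmul]
        exact Submodule.smul_mem _ _ (Submodule.mem_span_singleton_self a)
      | add x y hx hy =>
        obtain ⟨S, hS, h1⟩ := hx
        obtain ⟨S', hS', h2⟩ := hy
        refine ⟨S ⊔ S', inferInstance, fun φ => ?_⟩
        rw [map_add]
        exact add_mem (Submodule.mem_sup_left (h1 φ)) (Submodule.mem_sup_right (h2 φ))
    obtain ⟨S, hS, h1⟩ := this x
    refine Submodule.finiteDimensional_of_le (S₂ := S) ?_
    rintro _ ⟨φ, rfl⟩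
    exact h1 φ
  · rintro _ ⟨φ, rfl⟩
    refine ⟨-(φ ∘ₗ U), ?_⟩
    have := congrArg (sliceRight φ) h
    rw [map_add, sliceRight_rTensor, sliceRight_lTensor, map_zero] at this
    rw [map_neg]
    exact (eq_neg_of_add_eq_zero_left this).symm

/-- By flatness `x` lies in `ker T ⊗ W` and in `V ⊗ ker U`, so it is fixed by projections onto the
two kernels, and these send every pure tensor into the span. -/
theorem mem_span_tmul_of_ker {T : End K V} {U : End K W} {x : V ⊗[K] W}
    (hT : T.rTensor W x = 0) (hU : U.lTensor V x = 0) :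
    x ∈ Submodule.span K {t | ∃ a b, T a = 0 ∧ U b = 0 ∧ a ⊗ₜ[K] b = t} := by
  obtain ⟨π, hπ⟩ := (LinearMap.ker T).subtype.exists_leftInverse_of_injective
    (Submodule.ker_subtype _)
  obtain ⟨ρ, hρ⟩ := (LinearMap.ker U).subtype.exists_leftInverse_of_injective
    (Submodule.ker_subtype _)
  let π' : End K V := (LinearMap.ker T).subtype ∘ₗ π
  let ρ' : End K W := (LinearMap.ker U).subtype ∘ₗ ρ
  have h1 : π'.rTensor W x = x := by
    have : x ∈ LinearMap.range ((LinearMap.ker T).subtype.rTensor W) := by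
      have hex := Module.Flat.rTensor_exact W
        (f := (LinearMap.ker T).subtype) (g := T) (LinearMap.exact_subtype_ker_map T)
      exact (hex x).1 hT
    obtain ⟨y, rfl⟩ := this
    rw [← LinearMap.rTensor_comp_apply]
    congr 2
    rw [LinearMap.comp_assoc, hπ, LinearMap.comp_id]
  have h2 : ρ'.lTensor V x = x := by
    have : x ∈ LinearMap.range ((LinearMap.ker U).subtype.lTensor V) := by
      have hex := Module.Flat.lTensor_exact V
        (f := (LinearMap.ker U).subtype) (g := U) (LinearMap.exact_subtype_ker_map U)
      exact (hex x).1 hU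
    obtain ⟨y, rfl⟩ := this
    rw [← LinearMap.lTensor_comp_apply]
    congr 2
    rw [LinearMap.comp_assoc, hρ, LinearMap.comp_id]
  rw [← h1, ← h2]
  -- The projected tensor lies in the span for every `x`; forgetting the hypotheses on `x` permits
  -- induction.
  generalize x = x
  induction x with
  | zero => simp
  | add x y hx hy => simp only [map_add]; exact add_mem hx hy
  | tmul a b =>
    refine Submodule.subset_span ⟨π' a, ρ' b, (π a).2, (ρ b).2, by simp⟩

/-- An endomorphism of a vector space over an algebraically closed field without non-zero
eigenvalues is nilpotent on finite-dimensional invariant subspaces. -/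
theorem exists_pow_apply_eq_zero_of_eigenvalues [IsAlgClosed K] {T : End K V} {S : Submodule K V}
    [FiniteDimensional K S] (hS : ∀ v ∈ S, T v ∈ S)
    (hT : ∀ c : K, c ≠ 0 → ¬ T.HasEigenvalue c) : ∃ n : ℕ, ∀ v ∈ S, (T ^ n) v = 0 := by
  -- A non-zero generalized eigenspace of `R` contains an eigenvector, which is also one of `T`. So
  -- only the eigenvalue zero remains, and over an algebraically closed field the generalized
  -- eigenspaces fill `S`.
  let R : End K S := T.restrict hS
  have hbot : ∀ c : K, c ≠ 0 → R.maxGenEigenspace c = ⊥ := by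
    intro c hc
    by_contra hne
    obtain ⟨v, hv⟩ := 
      End.HasEigenvalue.exists_hasEigenvector
        (End.HasUnifEigenvalue.lt (k := ⊤) (m := 1) one_pos hne)
    refine hT c hc (End.hasEigenvalue_of_hasEigenvector (x := (v : V)) ⟨?_, ?_⟩)
    · exact End.mem_eigenspace_iff.2 (congrArg Subtype.val hv.apply_eq_smul)
    · exact fun h => hv.2 (Subtype.ext h)
  have htop : R.maxGenEigenspace 0 = ⊤ := by
    rw [eq_top_iff, ← End.iSup_maxGenEigenspace_eq_top R]
    refine iSup_le fun c => ?_
    by_cases hc : c = 0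
    · rw [hc]
    · rw [hbot c hc]; exact bot_le
  refine ⟨finrank K S, fun v hv => ?_⟩
  have hmem : (⟨v, hv⟩ : S) ∈ R.maxGenEigenspace 0 := htop ▸ Submodule.mem_top
  rw [End.maxGenEigenspace_eq_genEigenspace_finrank, End.mem_genEigenspace_nat, zero_smul,
    sub_zero, LinearMap.mem_ker, Module.End.pow_restrict] at hmem
  exact congrArg Subtype.val hmem

/-- The part of `w` in the non-zero eigenspaces also lies in the generalized eigenspace for zero, so
it vanishes by independence. -/
theorem apply_eq_zero_of_pow_apply_eq_zero {U : End K W} {w : W}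
    (hw : w ∈ ⨆ c, U.eigenspace c) {n : ℕ} (h : (U ^ n) w = 0) : U w = 0 := by
  have hle : ⨆ c, U.eigenspace c ≤ U.eigenspace 0 ⊔ ⨆ c ≠ (0 : K), U.eigenspace c := by
    refine iSup_le fun c => ?_
    by_cases hc : c = 0
    · rw [hc]; exact le_sup_left
    · exact le_sup_of_le_right (le_iSup₂_of_le c hc le_rfl)
  obtain ⟨a, ha, b, hb, rfl⟩ := Submodule.mem_sup.1 (hle hw)
  have h1 : ∀ c, U.eigenspace c ≤ U.maxGenEigenspace c := fun c =>
    (U.genEigenspace c).monotone le_top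
  have hb' : b ∈ ⨆ c ≠ (0 : K), U.maxGenEigenspace c := iSup₂_mono (fun c _ => h1 c) hb
  have hab : a + b ∈ U.maxGenEigenspace 0 :=
    (End.mem_maxGenEigenspace _ _ _).2 ⟨n, by rwa [zero_smul, sub_zero]⟩
  have hb0 : b ∈ U.maxGenEigenspace 0 := by simpa using sub_mem hab (h1 0 ha)
  have : b = 0 := Submodule.disjoint_def.1 (U.independent_maxGenEigenspace 0) b hb0 hb'
  rw [this, add_zero]
  simpa using End.mem_eigenspace_iff.1 ha

end KerTensor

/-! ### The kernel of `ad Γ` in terms of `F`, `C` and `D`. -/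

namespace PoissonType

open Module

variable {K : Type*} [Field K] {P : Type*} [Ring P] [Algebra K P]

theorem mem_F_of_invariant {z : P} {S : Submodule K P} [FiniteDimensional K S]
    (hS : ∀ v ∈ S, ad K z v ∈ S) {v : P} (hv : v ∈ S) : v ∈ F K z := by
  refine Submodule.finiteDimensional_of_le (S₂ := S) (Submodule.span_le.2 ?_)
  rintro _ ⟨n, rfl⟩
  change (ad K z ^ n) v ∈ S
  induction n with
  | zero => exact hv
  | succ n ih => rw [pow_succ', Module.End.mul_apply]; exact hS _ ih

theorem not_hasEigenvalue_of_Ev {z : P} (h : Ev K z = {0}) (c : K) (hc : c ≠ 0) :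
    ¬ (ad K z).HasEigenvalue c := by
  intro hev
  obtain ⟨v, hv⟩ := hev.exists_hasEigenvector
  have : c ∈ Ev K z := ⟨v, hv.2, hv.apply_eq_smul⟩
  rw [h] at this
  exact hc this

theorem mem_iSup_eigenspace_of_mem_D {z w : P} (h : w ∈ D K z) :
    w ∈ ⨆ c, (ad K z).eigenspace c :=
  (iSup₂_le fun c _ => le_iSup (fun c => (ad K z).eigenspace c) c) h

theorem ad_tensor_apply {Q : Type*} [Ring Q] [Algebra K Q] (z : P) (w : Q) (x : P ⊗[K] Q) :
    (z ⊗ₜ[K] 1 + 1 ⊗ₜ[K] w) * x - x * (z ⊗ₜ[K] 1 + 1 ⊗ₜ[K] w) =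
      (ad K z).rTensor Q x + (ad K w).lTensor P x := by
  induction x with
  | zero => simp
  | add x y hx hy => 
    rw [mul_add, add_mul x, map_add, map_add, add_add_add_comm, ← hx, ← hy]; abel
  | tmul a b =>
    simp only [add_mul, mul_add, Algebra.TensorProduct.tmul_mul_tmul, one_mul, mul_one,
      LinearMap.rTensor_tmul, LinearMap.lTensor_tmul, ad_apply, TensorProduct.sub_tmul,
      TensorProduct.tmul_sub]
    abel

theorem rTensor_eq_zero_of_C_eq_F {Q : Type*} [AddCommGroup Q] [Module K Q] {z : P}
    (hz : C K z = F K z) {U : End K Q} {x : P ⊗[K] Q}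
    (h : (ad K z).rTensor Q x + U.lTensor P x = 0) : (ad K z).rTensor Q x = 0 := by
  obtain ⟨S, hS, hinv, hmem⟩ := exists_invariant_sliceRight h
  refine eq_zero_of_sliceRight_eq_zero fun φ => ?_
  rw [sliceRight_rTensor]
  have := mem_F_of_invariant hinv (hmem φ)
  rwa [← hz] at this

theorem comm_lTensor_add_rTensor {V W : Type*} [AddCommGroup V] [Module K V] [AddCommGroup W]
    [Module K W] {T : End K V} {U : End K W} (x : V ⊗[K] W) :
    U.rTensor V (TensorProduct.comm K V W x) = TensorProduct.comm K V W (U.lTensor V x) ∧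
      T.lTensor W (TensorProduct.comm K V W x) = TensorProduct.comm K V W (T.rTensor W x) := by
  induction x with
  | zero => simp
  | add x y hx hy => simp only [map_add, hx.1, hx.2, hy.1, hy.2, and_self]
  | tmul a b => simp

theorem swap_eq_zero {V W : Type*} [AddCommGroup V] [Module K V] [AddCommGroup W]
    [Module K W] {T : End K V} {U : End K W} {x : V ⊗[K] W}
    (h : T.rTensor W x + U.lTensor V x = 0) :
    U.rTensor V (TensorProduct.comm K V W x) + T.lTensor W (TensorProduct.comm K V W x) = 0 := by
  rw [(comm_lTensor_add_rTensor (T := T) x).1, (comm_lTensor_add_rTensor (U := U) x).2, ← map_add,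
    add_comm, h, map_zero]

theorem rTensor_eq_zero_of_nilpotent_of_D_eq_F [IsAlgClosed K] {Q : Type*} [Ring Q]
    [Algebra K Q] {z : P} {w : Q} (hz : D K z = F K z) (hw : Ev K w = {0}) {x : P ⊗[K] Q}
    (h : (ad K z).rTensor Q x + (ad K w).lTensor P x = 0) : (ad K z).rTensor Q x = 0 := by
  obtain ⟨S, hS, hinv, hmem⟩ := exists_invariant_sliceRight h
  obtain ⟨S', hS', hinv', hmem'⟩ := exists_invariant_sliceRight (swap_eq_zero h)
  obtain ⟨n, hn⟩ := exists_pow_apply_eq_zero_of_eigenvalues hinv' (not_hasEigenvalue_of_Ev hw)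
  have hpow : ((ad K w) ^ n).lTensor P x = 0 := by
    have h0 : ((ad K w) ^ n).rTensor P (TensorProduct.comm K P Q x) = 0 :=
      eq_zero_of_sliceRight_eq_zero fun φ => by rw [sliceRight_rTensor, hn _ (hmem' φ)]
    -- Only the first half of the conjunction is needed, so `T` is filled with a dummy value.
    rw [(comm_lTensor_add_rTensor (T := (0 : End K P)) x).1] at h0
    exact (TensorProduct.comm K P Q).map_eq_zero_iff.1 h0
  have hzero : ∀ φ : Module.Dual K Q, sliceRight (φ ∘ₗ (ad K w) ^ n) x = 0 := fun φ => by
    rw [← sliceRight_lTensor, hpow, map_zero]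
  have hstep : ∀ φ : Module.Dual K Q,
      ad K z (sliceRight φ x) = - sliceRight (φ ∘ₗ ad K w) x := fun φ => by
    have := congrArg (sliceRight φ) h
    rw [map_add, sliceRight_rTensor, sliceRight_lTensor, map_zero] at this
    exact eq_neg_of_add_eq_zero_left this
  -- Powers of `ad z` on slices become powers of `ad w` on the form, which transfers nilpotency from
  -- `w` to `z`.
  have hiter : ∀ (m : ℕ) (φ : Module.Dual K Q),
      ((ad K z) ^ m) (sliceRight φ x) = (-1 : K) ^ m • sliceRight (φ ∘ₗ (ad K w) ^ m) x := by
    intro m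
    induction m with
    | zero => intro φ; simp [Module.End.one_eq_id]
    | succ m ih =>
      intro φ
      rw [pow_succ, Module.End.mul_apply, hstep, map_neg, ih, LinearMap.comp_assoc,
        ← Module.End.mul_eq_comp, ← pow_succ', pow_succ (-1 : K), mul_smul, neg_one_smul, smul_neg]
  refine eq_zero_of_sliceRight_eq_zero fun φ => ?_
  rw [sliceRight_rTensor]
  refine apply_eq_zero_of_pow_apply_eq_zero (n := n) (mem_iSup_eigenspace_of_mem_D ?_) ?_
  · rw [hz]; exact mem_F_of_invariant hinv (hmem φ)
  · rw [hiter, hzero, smul_zero]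

theorem commute_of_mem_span_tmul {Q : Type*} [Ring Q] [Algebra K Q] {z : P} {w : Q}
    (hz : ∀ a b : P, ad K z a = 0 → ad K z b = 0 → Commute a b)
    (hw : ∀ a b : Q, ad K w a = 0 → ad K w b = 0 → Commute a b) {x y : P ⊗[K] Q}
    (hx : x ∈ Submodule.span K {t | ∃ a b, ad K z a = 0 ∧ ad K w b = 0 ∧ a ⊗ₜ[K] b = t})
    (hy : y ∈ Submodule.span K {t | ∃ a b, ad K z a = 0 ∧ ad K w b = 0 ∧ a ⊗ₜ[K] b = t}) :
    Commute x y := by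
  induction hx using Submodule.span_induction with
  | zero => exact Commute.zero_left y
  | add x x' _ _ h h' => exact h.add_left h'
  | smul c x _ h => exact h.smul_left c
  | mem x hx =>
    obtain ⟨a, b, ha, hb, rfl⟩ := hx
    induction hy using Submodule.span_induction with
    | zero => exact Commute.zero_right _
    | add x x' _ _ h h' => exact h.add_right h'
    | smul c x _ h => exact h.smul_right c
    | mem y hy =>
      obtain ⟨a', b', ha', hb', rfl⟩ := hy
      rw [commute_iff_eq, Algebra.TensorProduct.tmul_mul_tmul, Algebra.TensorProduct.tmul_mul_tmul,
        (hz a a' ha ha').eq, (hw b b' hb hb').eq]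

end PoissonType

theorem corollary6 {K : Type*} [Field K] [IsAlgClosed K] [CharZero K]
    (z₁ z₂ : WeylAlgebra K 1)
    (hz₁ : z₁ ∉ Set.range (algebraMap K (WeylAlgebra K 1)))
    (hz₂ : z₂ ∉ Set.range (algebraMap K (WeylAlgebra K 1)))
    (Γ : WeylAlgebra K 2)
    (hΓ : Γ = WeylAlgebra.tensorEquiv (z₁ ⊗ₜ[K] 1 + 1 ⊗ₜ[K] z₂)) :
    (PoissonType.NilpotentType K z₁ ∧ PoissonType.SemisimpleType K z₂ →
      ∀ x ∈ PoissonType.C K Γ, ∀ y ∈ PoissonType.C K Γ, x * y = y * x) ∧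
    (PoissonType.Omega0' K z₁ ∨ PoissonType.Omega0' K z₂ →
      ∀ x ∈ PoissonType.C K Γ, ∀ y ∈ PoissonType.C K Γ, x * y = y * x) := by
  open PoissonType in
  have hcomm : ∀ z : WeylAlgebra K 1, z ∉ Set.range (algebraMap K (WeylAlgebra K 1)) →
      ∀ a b : WeylAlgebra K 1, ad K z a = 0 → ad K z b = 0 → Commute a b :=
    fun z hz a b ha hb => WeylAlgebra.commute_of_commute_nonscalar hz
      (sub_eq_zero.1 ha).symm (sub_eq_zero.1 hb).symm
  -- It suffices that one summand of `ad Γ` kills `t`: the other then does too, and `t` is a sum of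
  -- tensors of commuting-centralizer elements.
  have hred : (∀ t : WeylAlgebra K 1 ⊗[K] WeylAlgebra K 1,
      (ad K z₁).rTensor _ t + (ad K z₂).lTensor _ t = 0 →
        (ad K z₁).rTensor _ t = 0 ∨ (ad K z₂).lTensor _ t = 0) →
      ∀ x ∈ C K Γ, ∀ y ∈ C K Γ, x * y = y * x := by
    intro hker
    have hspan : ∀ x ∈ C K Γ, WeylAlgebra.tensorEquiv.symm x ∈
        Submodule.span K {t | ∃ a b, ad K z₁ a = 0 ∧ ad K z₂ b = 0 ∧ a ⊗ₜ[K] b = t} := by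
      intro x hx
      have h : (ad K z₁).rTensor _ (WeylAlgebra.tensorEquiv.symm x) +
          (ad K z₂).lTensor _ (WeylAlgebra.tensorEquiv.symm x) = 0 := by
        have hx' : Γ * x - x * Γ = 0 := hx
        rw [← ad_tensor_apply, ← map_eq_zero_iff _ WeylAlgebra.tensorEquiv.injective, map_sub,
          map_mul, map_mul, ← hΓ, AlgEquiv.apply_symm_apply, hx']
      rcases hker _ h with h' | h'
      · exact mem_span_tmul_of_ker h' (by rwa [h', zero_add] at h)
      · exact mem_span_tmul_of_ker (by rwa [h', add_zero] at h) h'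
    intro x hx y hy
    refine WeylAlgebra.tensorEquiv.symm.injective ?_
    rw [map_mul, map_mul]
    exact commute_of_mem_span_tmul (hcomm z₁ hz₁) (hcomm z₂ hz₂) (hspan x hx) (hspan y hy)
  have hswap : ∀ t : WeylAlgebra K 1 ⊗[K] WeylAlgebra K 1,
      (ad K z₂).rTensor _ (TensorProduct.comm K _ _ t) = 0 → (ad K z₂).lTensor _ t = 0 := by
    intro t ht
    rw [(comm_lTensor_add_rTensor (T := (0 : Module.End K (WeylAlgebra K 1))) t).1] at ht
    exact (TensorProduct.comm K _ _).map_eq_zero_iff.1 ht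
  -- The kernel lemmas treat the first tensor factor, so the factors are exchanged whenever the
  -- condition to exploit is on `z₂`.
  refine ⟨fun ⟨h1, h2⟩ => hred fun t ht => Or.inr (hswap t ?_),
    fun h => hred fun t ht => h.imp (fun h => rTensor_eq_zero_of_C_eq_F h.2.1 ht)
      fun h => hswap t (rTensor_eq_zero_of_C_eq_F h.2.1 (swap_eq_zero ht))⟩
  have hEv : Ev K z₁ = {0} := h1.elim And.left And.left
  have hDF : D K z₂ = F K z₂ := h2.elim (fun h => h.2.1) fun h => h.2.1
  exact rTensor_eq_zero_of_nilpotent_of_D_eq_F hDF hEv (swap_eq_zero ht)
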